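/- Let $G$ be a finite group and let $C\subset G$ be a conjugacy class whose elements generate $G$. Let $S(G,C)$ be the semigroup (with the empty word as identity) generated by letters $x_g$, $g\in C$, subject to the relations $x_{a}\cdot x_{b}=x_{b}\cdot x_{b^{-1}ab}=x_{aba^{-1}}\cdot x_{a}$ for $a,b\in C$. For $s=x_{g_1}\cdots x_{g_k}\in S(G,C)$ the length $ln(s)=k$, the product $\alpha(s)=g_1\cdots g_k\in G$ and the subgroup $G_s=\langle g_1,\dots,g_k\rangle$ are well defined. Let $h_k$ be the (finite) number of elements $s\in S(G,C)$ with $G_s=G$, $\alpha(s)=1$ and $ln(s)=k$, and put $\chi_{(G,C)}(t)=\sum_{k\ge 0}h_kt^k$. Let $G_\Gamma$ be the group with generators $y_g$, $g\in C$, and relations $y_b^{-1}y_ay_b=y_{b^{-1}ab}$ for $a,b\in C$, and let $\beta:G_\Gamma\to G$ be the homomorphism $y_g\mapsto g$. Then $\chi_{(G,C)}(t)$ is a rational function (already over $\mathbb Q$). Explicitly: the group $\ker\beta\cap[G_\Gamma,G_\Gamma]$ is finite; let $a$ be its order (the ambiguity index of $(G,C)$), and let $n=|C|$. Let $p$ be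 any positive integer such that $g^{pn}=1$ for all $g\in C$ (for example, the common order of the elements of $C$), and let $R$ be the set of integers $r$ with $0\le r\le pn-1$ for which there is some $i\equiv r \pmod{pn}$ with $h_i>0$. Then for every sufficiently large multiple $T$ of $pn$, $$\chi_{(G,C)}(t)=\sum_{k<T}h_kt^k+\frac{a\,t^T}{1-t^{pn}}\sum_{r\in R}t^r .$$ -/

import Mathlib

namespace EquippedGroup

variable {G : Type*} [Group G]

/-! ### The factorization semigroup -/

/-- The defining relations `x_a · x_b = x_b · x_{b⁻¹ a b}` and `x_a · x_b = x_{a b a⁻¹} · x_a`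
of the factorization semigroup, between words in the letters `x_g`, `g ∈ O`. -/
inductive FactRel (O : Set G) : FreeMonoid O → FreeMonoid O → Prop
  | right (a b c : O) (h : (c : G) = (b : G)⁻¹ * a * b) :
      FactRel O (FreeMonoid.of a * FreeMonoid.of b) (FreeMonoid.of b * FreeMonoid.of c)
  | left (a b c : O) (h : (c : G) = (a : G) * b * (a : G)⁻¹) :
      FactRel O (FreeMonoid.of a * FreeMonoid.of b) (FreeMonoid.of c * FreeMonoid.of a)

/-- The factorization semigroup `S(G, O)` (the empty word is included as the identity). -/
abbrev FactSemigroup (O : Set G) : Type _ := PresentedMonoid (FactRel O)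

/-- The product homomorphism `α : S(G, O) → G`, `x_g ↦ g`. -/
def alpha (O : Set G) : FactSemigroup O →* G :=
  PresentedMonoid.lift (fun g : O => (g : G)) (by
    rintro _ _ (⟨a, b, c, h⟩ | ⟨a, b, c, h⟩) <;> simp [h, mul_assoc])

/-- The length homomorphism, as a homomorphism to the multiplicative copy of `ℕ`. -/
def lengthHom (O : Set G) : FactSemigroup O →* Multiplicative ℕ :=
  PresentedMonoid.lift (fun _ : O => Multiplicative.ofAdd 1) (by
    rintro _ _ (⟨a, b, c, h⟩ | ⟨a, b, c, h⟩) <;> simp)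

/-- The length `ln(s)`: the number of factors of `s`. If `O` is a single conjugacy class, this
is the type of `s`. -/
def length {O : Set G} (s : FactSemigroup O) : ℕ := (lengthHom O s).toAdd

/-- The subgroup of `G` generated by the letters of a word. -/
def wordSubgroup (O : Set G) (w : FreeMonoid O) : Subgroup G :=
  Subgroup.closure {g : G | ∃ x ∈ w.toList, (x : G) = g}

theorem wordSubgroup_mul (O : Set G) (v w : FreeMonoid O) :
    wordSubgroup O (v * w) = wordSubgroup O v ⊔ wordSubgroup O w := by
  unfold wordSubgroup
  rw [← Subgroup.closure_union]
  congr 1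
  ext g
  simp only [FreeMonoid.toList_mul, List.mem_append, Set.mem_ofPred_eq, Set.mem_union]
  grind

theorem wordSubgroup_of_mul_of (O : Set G) (a b : O) :
    wordSubgroup O (FreeMonoid.of a * FreeMonoid.of b) = Subgroup.closure {(a : G), (b : G)} := by
  unfold wordSubgroup
  congr 1
  ext g
  simp only [FreeMonoid.toList_mul, FreeMonoid.toList_of, List.mem_append, List.mem_singleton,
    Set.mem_ofPred_eq, Set.mem_insert_iff, Set.mem_singleton_iff]
  grind

/-- Two words are related if their letters generate the same subgroup. -/
def wordSubgroupCon (O : Set G) : Con (FreeMonoid O) where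
  r v w := wordSubgroup O v = wordSubgroup O w
  iseqv := ⟨fun _ => rfl, fun h => h.symm, fun h h' => h.trans h'⟩
  mul' h h' := by rw [wordSubgroup_mul, wordSubgroup_mul, h, h']

theorem conGen_factRel_le (O : Set G) : conGen (FactRel O) ≤ wordSubgroupCon O := by
  rw [Con.conGen_le]
  rintro _ _ (⟨a, b, c, h⟩ | ⟨a, b, c, h⟩)
  all_goals
    change wordSubgroup O _ = wordSubgroup O _
    rw [wordSubgroup_of_mul_of, wordSubgroup_of_mul_of]
    apply le_antisymm <;> rw [Subgroup.closure_le, Set.insert_subset_iff, Set.singleton_subset_iff]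
  · have hb : (b : G) ∈ Subgroup.closure {(b : G), (c : G)} := Subgroup.subset_closure (by simp)
    have hc : (c : G) ∈ Subgroup.closure {(b : G), (c : G)} := Subgroup.subset_closure (by simp)
    have ha : (a : G) = b * c * (b : G)⁻¹ := by rw [h]; group
    exact ⟨ha ▸ mul_mem (mul_mem hb hc) (inv_mem hb), hb⟩
  · have ha : (a : G) ∈ Subgroup.closure {(a : G), (b : G)} := Subgroup.subset_closure (by simp)
    have hb : (b : G) ∈ Subgroup.closure {(a : G), (b : G)} := Subgroup.subset_closure (by simp)
    exact ⟨hb, h ▸ mul_mem (mul_mem (inv_mem hb) ha) hb⟩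
  · have ha : (a : G) ∈ Subgroup.closure {(c : G), (a : G)} := Subgroup.subset_closure (by simp)
    have hc : (c : G) ∈ Subgroup.closure {(c : G), (a : G)} := Subgroup.subset_closure (by simp)
    have hb : (b : G) = (a : G)⁻¹ * c * a := by rw [h]; group
    exact ⟨ha, hb ▸ mul_mem (mul_mem (inv_mem ha) hc) ha⟩
  · have ha : (a : G) ∈ Subgroup.closure {(a : G), (b : G)} := Subgroup.subset_closure (by simp)
    have hb : (b : G) ∈ Subgroup.closure {(a : G), (b : G)} := Subgroup.subset_closure (by simp)
    exact ⟨h ▸ mul_mem (mul_mem ha hb) (inv_mem ha), ha⟩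

/-- The subgroup `G_s` of `G` generated by the factors of `s ∈ S(G, O)`. -/
def factorSubgroup {O : Set G} (s : FactSemigroup O) : Subgroup G :=
  Quotient.lift (wordSubgroup O) (fun _ _ h => conGen_factRel_le O h) s

theorem factorSubgroup_mk (O : Set G) (w : FreeMonoid O) :
    factorSubgroup (PresentedMonoid.mk (FactRel O) w) = wordSubgroup O w := rfl

/-- The elements `s` of `S(G, O)` with `G_s = G`, `α(s) = 1` and `ln(s) = k`. -/
def fullUnitFactorizations (O : Set G) (k : ℕ) : Set (FactSemigroup O) :=
  {s | factorSubgroup s = ⊤ ∧ alpha O s = 1 ∧ length s = k}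

/-- For finite `O` there are only finitely many such elements, so that counting them is
meaningful. -/
theorem finite_fullUnitFactorizations (O : Set G) [Finite O] (k : ℕ) :
    (fullUnitFactorizations O k).Finite := by
  have hl : ∀ w : FreeMonoid O,
      lengthHom O (PresentedMonoid.mk (FactRel O) w) = Multiplicative.ofAdd w.length := by
    intro w
    induction w using FreeMonoid.inductionOn' with
    | one => simp
    | of_mul x w ih =>
      rw [map_mul, map_mul, ih, FreeMonoid.length_mul, FreeMonoid.length_of, ofAdd_add]
      rfl
  refine ((List.finite_length_eq O k).image
    (fun l => PresentedMonoid.mk (FactRel O) (FreeMonoid.ofList l))).subset ?_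
  rintro s ⟨-, -, hs⟩
  obtain ⟨w, rfl⟩ := PresentedMonoid.surjective_mk s
  refine ⟨w.toList, ?_, rfl⟩
  have : w.length = k := by
    rw [← hs, length, hl]
    rfl
  exact this

/-- `h_k`, the number of elements of `S(G, O)` with `G_s = G`, `α(s) = 1` and `ln(s) = k`. -/
noncomputable def factCount (O : Set G) (k : ℕ) : ℕ := (fullUnitFactorizations O k).ncard

/-- The generating function `χ_{(G, C)}(t) = ∑ h_k t^k` of a conjugacy class `C`. -/
noncomputable def chi (C : ConjClasses G) : PowerSeries ℚ :=
  PowerSeries.mk fun k => (factCount C.carrier k : ℚ)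

/-! ### The `C`-group and the ambiguity index -/

/-- The relators of the `C`-group: one relation `y_b⁻¹ y_a y_b = y_c` for all `a, b, c ∈ O`
with `b⁻¹ a b = c`. -/
def cRelators (O : Set G) : Set (FreeGroup O) :=
  {w | ∃ a b c : O, (b : G)⁻¹ * a * b = c ∧
    w = (FreeGroup.of b)⁻¹ * FreeGroup.of a * FreeGroup.of b * (FreeGroup.of c)⁻¹}

/-- The `C`-group `G_Γ` associated with the `C`-graph of `(G, O)`. -/
abbrev CGroup (O : Set G) : Type _ := PresentedGroup (cRelators O)

/-- The homomorphism `β : G_Γ → G`, `y_g ↦ g`. -/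
def beta (O : Set G) : CGroup O →* G :=
  PresentedGroup.toGroup (f := fun g : O => (g : G)) (by
    rintro _ ⟨a, b, c, h, rfl⟩
    simp [h])

/-- The subgroup `ker β ∩ [G_Γ, G_Γ]` of the `C`-group. -/
def ambiguitySubgroup (O : Set G) : Subgroup (CGroup O) := (beta O).ker ⊓ commutator (CGroup O)

/-- The ambiguity index `a_{(G, O)} = |ker β ∩ [G_Γ, G_Γ]|`. -/
noncomputable def ambiguityIndex (O : Set G) : ℕ := Nat.card (ambiguitySubgroup O)

/-! ### Residues of the support -/

open Classical in
/-- The set of residues `0 ≤ r < N` such that `h_i > 0` for some `i ≡ r (mod N)`. -/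
noncomputable def residues (O : Set G) (N : ℕ) : Finset ℕ :=
  (Finset.range N).filter fun r => ∃ i : ℕ, i ≡ r [MOD N] ∧ 0 < factCount O i

end EquippedGroup

/-! Put N = pn, so that g^N = 1 on C. Moving a letter past s conjugates it by α(s), so every x_a^N
is central, and x_a^N · s does not depend on a when s is full (`letter_pow_mul_congr`). By
pigeonhole a long full s is x_a^N times a full element. Hence multiplication by x_a^N maps the full
elements of length k onto those of length k + N for large k. The finite cardinalities then stabilize
along each residue class, so the map becomes injective and yields left cancellation
(`exists_forall_mul_left_cancel`).

Inverting the center embeds the question in the C-group: elements with equal images there agree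
after a common left multiplication, so long full ones of equal length agree. Conversely, each
element of large degree in the C-group comes from a full element. Thus h_k eventually counts the
elements with β = 1 and degree k (`exists_forall_bijOn_toCGroup`). Such a fibre is empty or a coset
of ker β ∩ ker degree, where ker degree is the commutator subgroup. Multiplication by y_a^N shifts
the degree by N, so emptiness depends only on k mod N. A geometric series finishes the proof. -/

namespace EquippedGroup

/-! ### Conjugation of letters, central powers and full elements. -/

section Semigroup

variable {G : Type*} [Group G]

/-- The letter `x_a` of the factorization semigroup. -/
def letter {O : Set G} (a : O) : FactSemigroup O := PresentedMonoid.of (FactRel O) a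

@[elab_as_elim]
theorem factSemigroup_induction {O : Set G} {P : FactSemigroup O → Prop} (s : FactSemigroup O)
    (one : P 1) (letter_mul : ∀ a s, P s → P (letter a * s)) : P s := by
  obtain ⟨w, rfl⟩ := PresentedMonoid.surjective_mk s
  induction w using FreeMonoid.inductionOn' with
  | one => exact one
  | of_mul a w ih => exact letter_mul a _ ih

@[simp]
theorem alpha_letter {O : Set G} (a : O) : alpha O (letter a) = a := rfl

@[simp]
theorem length_one {O : Set G} : length (1 : FactSemigroup O) = 0 := by
  simp [length]

@[simp]
theorem length_letter {O : Set G} (a : O) : length (letter a) = 1 := rfl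

@[simp]
theorem length_mul {O : Set G} (s t : FactSemigroup O) : length (s * t) = length s + length t := by
  simp [length]

@[simp]
theorem length_pow {O : Set G} (s : FactSemigroup O) (m : ℕ) :
    length (s ^ m) = m * length s := by
  simp [length]

theorem length_mk {O : Set G} (w : FreeMonoid O) :
    length (PresentedMonoid.mk (FactRel O) w) = w.length := by
  induction w using FreeMonoid.inductionOn' with
  | one => simp
  | of_mul a w ih =>
    rw [map_mul, length_mul, ih, FreeMonoid.length_mul, FreeMonoid.length_of]
    rfl

@[simp]
theorem factorSubgroup_mul {O : Set G} (s t : FactSemigroup O) :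
    factorSubgroup (s * t) = factorSubgroup s ⊔ factorSubgroup t := by
  obtain ⟨v, rfl⟩ := PresentedMonoid.surjective_mk s
  obtain ⟨w, rfl⟩ := PresentedMonoid.surjective_mk t
  rw [← map_mul, factorSubgroup_mk, factorSubgroup_mk, factorSubgroup_mk, wordSubgroup_mul]

theorem factorSubgroup_letter_pow_succ {O : Set G} (a : O) (m : ℕ) :
    factorSubgroup (letter a ^ (m + 1)) = factorSubgroup (letter a) := by
  induction m with
  | zero => simp
  | succ m ih => rw [pow_succ, factorSubgroup_mul, ih, sup_idem]

variable {C : ConjClasses G}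

/-- Conjugation `a ↦ h a h⁻¹` on a conjugacy class. -/
def conjBy (h : G) (a : C.carrier) : C.carrier :=
  ⟨h * a * h⁻¹, by
    have ha := a.2
    rw [ConjClasses.mem_carrier_iff_mk_eq] at ha ⊢
    exact (ConjClasses.mk_eq_mk_iff_isConj.2 (isConj_iff.2 ⟨h, rfl⟩)).symm.trans ha⟩

@[simp]
theorem coe_conjBy (h : G) (a : C.carrier) : (conjBy h a : G) = h * a * h⁻¹ := rfl

@[simp]
theorem conjBy_one (a : C.carrier) : conjBy 1 a = a := Subtype.ext (by simp)

theorem conjBy_mul (g h : G) (a : C.carrier) : conjBy (g * h) a = conjBy g (conjBy h a) :=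
  Subtype.ext (by simp [mul_assoc])

theorem exists_conjBy_eq (a b : C.carrier) : ∃ h : G, conjBy h a = b := by
  have h : IsConj (a : G) b := by
    rw [← ConjClasses.mk_eq_mk_iff_isConj]
    exact (ConjClasses.mem_carrier_iff_mk_eq.1 a.2).trans
      (ConjClasses.mem_carrier_iff_mk_eq.1 b.2).symm
  obtain ⟨c, hc⟩ := isConj_iff.1 h
  exact ⟨c, Subtype.ext hc⟩

/-- A function on a conjugacy class that is invariant under conjugation by a generating set
is constant. -/
theorem eq_of_conjBy_invariant {X : Type*} {S : Set G} (hS : Subgroup.closure S = ⊤)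
    (f : C.carrier → X) (hf : ∀ h ∈ S, ∀ a, f (conjBy h a) = f a) (a b : C.carrier) :
    f a = f b := by
  obtain ⟨h, rfl⟩ := exists_conjBy_eq a b
  have hh : h ∈ Subgroup.closure S := hS ▸ Subgroup.mem_top h
  clear hS
  induction hh using Subgroup.closure_induction generalizing a with
  | mem x hx => exact (hf x hx a).symm
  | one => simp
  | mul x y _ _ ihx ihy => rw [conjBy_mul, ← ihx, ← ihy]
  | inv x _ ih => rw [ih (conjBy x⁻¹ a), ← conjBy_mul]; simp

theorem letter_mul_letter (a b : C.carrier) :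
    letter a * letter b = letter (conjBy (a : G) b) * letter a :=
  PresentedMonoid.mk_eq_mk_of_rel (FactRel.left a b _ rfl)

theorem mul_letter (s : FactSemigroup C.carrier) (a : C.carrier) :
    s * letter a = letter (conjBy (alpha _ s) a) * s := by
  induction s using factSemigroup_induction generalizing a with
  | one => simp
  | letter_mul b s ih =>
    rw [mul_assoc, ih, ← mul_assoc, letter_mul_letter, mul_assoc, map_mul, conjBy_mul]
    rfl

theorem mul_letter_pow (s : FactSemigroup C.carrier) (a : C.carrier) (m : ℕ) :
    s * letter a ^ m = letter (conjBy (alpha _ s) a) ^ m * s :=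
  SemiconjBy.pow_right (show SemiconjBy s _ _ from mul_letter s a) m

theorem mem_center_of_alpha_eq_one {s : FactSemigroup C.carrier} (hs : alpha _ s = 1) :
    s ∈ Submonoid.center (FactSemigroup C.carrier) := by
  rw [Submonoid.mem_center_iff]
  intro t
  induction t using factSemigroup_induction with
  | one => simp
  | letter_mul a t ih =>
    rw [mul_assoc, ih, ← mul_assoc, ← mul_assoc, mul_letter, hs, conjBy_one]

theorem letter_pow_mem_center {N : ℕ} (hN : ∀ g ∈ C.carrier, g ^ N = 1) (a : C.carrier) :
    letter a ^ N ∈ Submonoid.center (FactSemigroup C.carrier) :=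
  mem_center_of_alpha_eq_one (by rw [map_pow, alpha_letter, hN a a.2])

/-- A factorization is full if its factors generate the group. -/
def IsFull {O : Set G} (s : FactSemigroup O) : Prop := factorSubgroup s = ⊤

theorem IsFull.mul_left {O : Set G} {t : FactSemigroup O} (ht : IsFull t) (s : FactSemigroup O) :
    IsFull (s * t) := by
  rw [IsFull, factorSubgroup_mul, ht, sup_top_eq]

theorem IsFull.mul_right {O : Set G} {s : FactSemigroup O} (hs : IsFull s) (t : FactSemigroup O) :
    IsFull (s * t) := by
  rw [IsFull, factorSubgroup_mul, hs, top_sup_eq]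

/-- For a letter h of s, x_{hah⁻¹}^N x_h = x_h x_a^N = x_a^N x_h, and centrality brings the power
next to h inside s. The letters of s generate G, so the class C is a single orbit under such
conjugations. -/
theorem letter_pow_mul_congr {N : ℕ} (hN : ∀ g ∈ C.carrier, g ^ N = 1)
    {s : FactSemigroup C.carrier} (hs : IsFull s) (a b : C.carrier) :
    letter a ^ N * s = letter b ^ N * s := by
  obtain ⟨w, rfl⟩ := PresentedMonoid.surjective_mk s
  refine eq_of_conjBy_invariant hs (fun a => letter a ^ N * PresentedMonoid.mk _ w) ?_ a b
  rintro _ ⟨h, hh, rfl⟩ a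
  obtain ⟨w₁, w₂, hw⟩ := List.append_of_mem hh
  have hw : w = FreeMonoid.ofList w₁ * (FreeMonoid.of h * FreeMonoid.ofList w₂) := hw
  have hc := fun a => Submonoid.mem_center_iff.1 (letter_pow_mem_center hN a)
  have key : letter (conjBy (h : G) a) ^ N * letter h = letter a ^ N * letter h := by
    rw [← hc a, mul_letter_pow]
    rfl
  have key' : ∀ x y : FactSemigroup C.carrier,
      letter (conjBy (h : G) a) ^ N * (x * (letter h * y)) =
        letter a ^ N * (x * (letter h * y)) := by
    intro x y
    rw [← mul_assoc, ← hc, mul_assoc, ← mul_assoc (_ ^ N), key, mul_assoc, ← mul_assoc x, hc,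
      mul_assoc]
  subst hw
  rw [map_mul, map_mul]
  exact key' _ _

theorem exists_eq_letter_pow_mul [DecidableEq C.carrier] (a : C.carrier) (w : List C.carrier) (m : ℕ)
    (hm : m ≤ w.count a) :
    ∃ t, PresentedMonoid.mk (FactRel C.carrier) (FreeMonoid.ofList w) = letter a ^ m * t := by
  induction w generalizing m with
  | nil => exact ⟨1, by simp at hm; simp [hm]⟩
  | cons b w ih =>
    have hb : PresentedMonoid.mk (FactRel C.carrier) (FreeMonoid.ofList (b :: w)) =
      letter b * PresentedMonoid.mk (FactRel C.carrier) (FreeMonoid.ofList w) := rfl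
    rw [hb]
    by_cases hab : b = a
    · subst hab
      obtain _ | m := m
      · exact ⟨letter b * PresentedMonoid.mk (FactRel C.carrier) (FreeMonoid.ofList w), by simp⟩
      · rw [List.count_cons_self] at hm
        obtain ⟨t, ht⟩ := ih m (by omega)
        exact ⟨t, by rw [ht, pow_succ', mul_assoc]⟩
    · rw [List.count_cons_of_ne hab] at hm
      obtain ⟨t, ht⟩ := ih m hm
      -- Moving x_b to the right across x_a^m conjugates it by a^{-m}.
      refine ⟨letter (conjBy ((a : G) ^ m)⁻¹ b) * t, ?_⟩
      rw [ht, ← mul_assoc, ← mul_assoc, mul_letter, ← conjBy_mul, map_pow, alpha_letter,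
        mul_inv_cancel, conjBy_one]

/-- A long full factorization is divisible by the `N`-th power of a letter, with a full
quotient. -/
theorem IsFull.exists_eq_letter_pow_mul [Finite C.carrier] {N : ℕ}
    {s : FactSemigroup C.carrier} (hs : IsFull s) (hl : Nat.card C.carrier * N < length s) :
    ∃ a t, IsFull t ∧ s = letter a ^ N * t := by
  have := Classical.decEq C.carrier
  have := Fintype.ofFinite C.carrier
  obtain ⟨w, rfl⟩ := PresentedMonoid.surjective_mk s
  obtain ⟨a, ha⟩ : ∃ a : C.carrier, N < w.toList.count a := by
    by_contra! h
    have h1 : ∑ a ∈ w.toList.toFinset, w.toList.count a = w.toList.length :=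
      List.sum_toFinset_count_eq_length _
    have h2 : ∑ a ∈ w.toList.toFinset, w.toList.count a ≤ w.toList.toFinset.card * N :=
      (Finset.sum_le_card_nsmul _ _ _ fun a _ => h a).trans (by simp)
    have h3 : w.toList.toFinset.card ≤ Nat.card C.carrier := by
      rw [Nat.card_eq_fintype_card]
      exact Finset.card_le_univ _
    rw [length_mk] at hl
    have h4 : w.length = w.toList.length := rfl
    have := Nat.mul_le_mul_right N h3
    omega
  -- Extracting N + 1 copies leaves one x_a in the quotient, which keeps it full.
  obtain ⟨t, ht⟩ := EquippedGroup.exists_eq_letter_pow_mul a w.toList (N + 1) ha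
  have ht : PresentedMonoid.mk (FactRel C.carrier) w = letter a ^ (N + 1) * t := ht
  refine ⟨a, letter a * t, ?_, by rw [ht, pow_succ, mul_assoc]⟩
  rw [ht, IsFull, factorSubgroup_mul, factorSubgroup_letter_pow_succ] at hs
  rwa [IsFull, factorSubgroup_mul]

theorem finite_length_eq (O : Set G) [Finite O] (k : ℕ) :
    {s : FactSemigroup O | length s = k}.Finite := by
  refine ((List.finite_length_eq O k).image
    (fun l => PresentedMonoid.mk (FactRel O) (FreeMonoid.ofList l))).subset ?_
  intro s hs
  obtain ⟨w, rfl⟩ := PresentedMonoid.surjective_mk s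
  exact ⟨w.toList, by rw [Set.mem_ofPred_eq, length_mk] at hs; exact hs, rfl⟩

/-- The full factorizations of length `k`. -/
def fullOfLength (O : Set G) (k : ℕ) : Set (FactSemigroup O) := {s | IsFull s ∧ length s = k}

theorem finite_fullOfLength (O : Set G) [Finite O] (k : ℕ) : (fullOfLength O k).Finite :=
  (finite_length_eq O k).subset fun _ hs => hs.2

end Semigroup

/-- A natural-valued function with `f (k + N) ≤ f k` for large `k` is eventually `N`-periodic. -/
theorem exists_forall_add_eq_of_add_le (f : ℕ → ℕ) (N k₀ : ℕ)
    (hf : ∀ k, k₀ ≤ k → f (k + N) ≤ f k) : ∃ K, k₀ ≤ K ∧ ∀ k, K ≤ k → f (k + N) = f k := by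
  -- Sums over windows of length N are antitone in ℕ, hence eventually constant. Sliding a window by
  -- one changes its sum by f (k + N) - f k.
  let g : ℕ → ℕ := fun j => ∑ i ∈ Finset.range N, f (k₀ + j + i)
  have hg : ∀ j, g (j + 1) + f (k₀ + j) = g j + f (k₀ + j + N) := by
    intro j
    have h1 := Finset.sum_range_succ (fun i => f (k₀ + j + i)) N
    have h2 := Finset.sum_range_succ' (fun i => f (k₀ + j + i)) N
    have h3 : g (j + 1) = ∑ i ∈ Finset.range N, f (k₀ + j + (i + 1)) :=
      Finset.sum_congr rfl fun i _ => by congr 1; omega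
    rw [h3]
    simp only [add_zero] at h2
    exact h2.symm.trans h1
  have hanti : Antitone g := antitone_nat_of_succ_le fun j => by
    have := hg j
    have := hf (k₀ + j) (by omega)
    omega
  obtain ⟨J, hJ⟩ := WellFoundedGT.monotone_chain_condition
    (⟨fun j => OrderDual.toDual (g j), hanti.dual_right⟩ : ℕ →o ℕᵒᵈ)
  refine ⟨k₀ + J, by omega, fun k hk => ?_⟩
  obtain ⟨j, rfl⟩ := Nat.exists_eq_add_of_le (show k₀ ≤ k by omega)
  have h1 : g J = g j := hJ j (by omega)
  have h2 : g J = g (j + 1) := hJ (j + 1) (by omega)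
  have := hg j
  omega

/-! ### Stabilization of the counts and left cancellation. -/

section Stability

variable {G : Type*} [Group G] {C : ConjClasses G} [Finite C.carrier] {N : ℕ}

theorem image_letter_pow_mul_fullOfLength (hN : ∀ g ∈ C.carrier, g ^ N = 1) (a : C.carrier)
    {k : ℕ} (hk : Nat.card C.carrier * N < k + N) :
    (fun s => letter a ^ N * s) '' fullOfLength C.carrier k = fullOfLength C.carrier (k + N) := by
  ext s
  constructor
  · rintro ⟨t, ⟨ht, rfl⟩, rfl⟩
    exact ⟨ht.mul_left _, by simp [add_comm]⟩
  · rintro ⟨hs, hl⟩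
    obtain ⟨b, t, ht, rfl⟩ := hs.exists_eq_letter_pow_mul (N := N) (by omega)
    refine ⟨t, ⟨ht, ?_⟩, letter_pow_mul_congr hN ht a b⟩
    simp at hl
    omega

/-- For large `k`, letters are left cancellable on full factorizations of length `k`. -/
theorem exists_forall_mul_left_cancel (hN : ∀ g ∈ C.carrier, g ^ N = 1) (hN0 : 0 < N) :
    ∃ K, ∀ s t c : FactSemigroup C.carrier, IsFull s → IsFull t → length s = length t →
      K ≤ length s → c * s = c * t → s = t := by
  obtain ⟨a⟩ : Nonempty C.carrier := by
    obtain ⟨g, rfl⟩ := ConjClasses.exists_rep C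
    exact ⟨⟨g, ConjClasses.mem_carrier_mk⟩⟩
  obtain ⟨K, hK₀, hK⟩ := exists_forall_add_eq_of_add_le
    (fun k => (fullOfLength C.carrier k).ncard) N (Nat.card C.carrier * N) fun k hk => by
      rw [← image_letter_pow_mul_fullOfLength hN a (by omega)]
      exact Set.ncard_image_le (finite_fullOfLength _ _)
  have hinj : ∀ k, K ≤ k →
      Set.InjOn (fun s => letter a ^ N * s) (fullOfLength C.carrier k) := by
    intro k hk
    have h := hK k hk
    rw [← image_letter_pow_mul_fullOfLength hN a (by omega)] at h
    exact Set.injOn_of_ncard_image_eq h (finite_fullOfLength _ _)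
  refine ⟨K, fun s t c hs ht hst hl h => ?_⟩
  induction c using factSemigroup_induction with
  | one => simpa using h
  | letter_mul b c ih =>
    refine ih (hinj (length (c * s)) (by simp; omega) ⟨hs.mul_left c, rfl⟩
      ⟨ht.mul_left c, by simp [hst]⟩ ?_)
    beta_reduce
    -- After replacing x_a^N by x_b^N, one factor x_b is supplied by `h`.
    rw [letter_pow_mul_congr hN (hs.mul_left c) a b, letter_pow_mul_congr hN (ht.mul_left c) a b]
    obtain ⟨m, rfl⟩ := Nat.exists_eq_succ_of_ne_zero hN0.ne'
    rw [Nat.succ_eq_add_one, pow_succ, mul_assoc, mul_assoc, ← mul_assoc (letter b),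
      ← mul_assoc (letter b), h]

end Stability

end EquippedGroup

namespace EquippedGroup

/-! ### Comparison with the C-group. -/

section CGroup

variable {G : Type*} [Group G]

/-- The canonical homomorphism from the factorization semigroup to the `C`-group. -/
def toCGroup (O : Set G) : FactSemigroup O →* CGroup O :=
  PresentedMonoid.lift (fun a : O => (PresentedGroup.of a : CGroup O)) (by
    have hrel : ∀ a b c : O, (b : G)⁻¹ * a * b = c →
        (PresentedGroup.of a * PresentedGroup.of b : CGroup O) =
          PresentedGroup.of b * PresentedGroup.of c := by
      intro a b c h
      have h1 : (PresentedGroup.of b)⁻¹ * PresentedGroup.of a * PresentedGroup.of b *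
          (PresentedGroup.of c)⁻¹ = (1 : CGroup O) :=
        PresentedGroup.one_of_mem (rels := cRelators O) ⟨a, b, c, h, rfl⟩
      rw [mul_inv_eq_one, mul_assoc, inv_mul_eq_iff_eq_mul] at h1
      exact h1
    rintro _ _ (⟨a, b, c, h⟩ | ⟨a, b, c, h⟩)
    · simpa using hrel a b c h.symm
    · simpa using (hrel c a b (by rw [h]; group)).symm)

@[simp]
theorem toCGroup_letter {O : Set G} (a : O) : toCGroup O (letter a) = PresentedGroup.of a := rfl

/-- The degree homomorphism `y_g ↦ 1` of the `C`-group. -/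
def degree (O : Set G) : CGroup O →* Multiplicative ℤ :=
  PresentedGroup.toGroup (f := fun _ : O => Multiplicative.ofAdd (1 : ℤ)) (by
    rintro _ ⟨a, b, c, h, rfl⟩
    simp)

@[simp]
theorem degree_of {O : Set G} (a : O) :
    degree O (PresentedGroup.of a) = Multiplicative.ofAdd 1 :=
  PresentedGroup.toGroup.of _

@[simp]
theorem beta_of {O : Set G} (a : O) : beta O (PresentedGroup.of a) = a :=
  PresentedGroup.toGroup.of _

@[simp]
theorem degree_toCGroup {O : Set G} (s : FactSemigroup O) :
    degree O (toCGroup O s) = Multiplicative.ofAdd (length s : ℤ) := by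
  induction s using factSemigroup_induction with
  | one => simp
  | letter_mul a s ih => simp [ih, ofAdd_add]

@[simp]
theorem beta_toCGroup {O : Set G} (s : FactSemigroup O) :
    beta O (toCGroup O s) = alpha O s := by
  induction s using factSemigroup_induction with
  | one => simp
  | letter_mul a s ih => simp [ih]

/-- The center of a monoid is an Ore set. -/
@[reducible]
def oreSetCenter (M : Type*) [Monoid M] : OreLocalization.OreSet (Submonoid.center M) where
  ore_right_cancel r₁ r₂ s h := ⟨s, by
    rw [← Submonoid.mem_center_iff.1 s.2, ← Submonoid.mem_center_iff.1 s.2, h]⟩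
  oreNum r _ := r
  oreDenom _ s := s
  ore_eq r s := (Submonoid.mem_center_iff.1 s.2 r).symm

variable {C : ConjClasses G} {N : ℕ}

/-- In the localization at the center each x_a is a unit, because x_a^N is. The numerator map
therefore factors through the C-group, and two numerators coincide only after a common left
multiplication. -/
theorem exists_mul_eq_mul_of_toCGroup_eq (hN : ∀ g ∈ C.carrier, g ^ N = 1) (hN0 : 0 < N)
    {s t : FactSemigroup C.carrier} (h : toCGroup _ s = toCGroup _ t) : ∃ c, c * s = c * t := by
  let _ := oreSetCenter (FactSemigroup C.carrier)
  let φ : FactSemigroup C.carrier →*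
      OreLocalization (Submonoid.center (FactSemigroup C.carrier)) (FactSemigroup C.carrier) :=
    OreLocalization.numeratorHom
  have hu : ∀ a : C.carrier, IsUnit (φ (letter a)) := fun a => by
    rw [← isUnit_pow_iff hN0.ne', ← map_pow]
    exact OreLocalization.numerator_isUnit ⟨_, letter_pow_mem_center hN a⟩
  let ψ : CGroup C.carrier →* (OreLocalization (Submonoid.center (FactSemigroup C.carrier))
      (FactSemigroup C.carrier))ˣ :=
    PresentedGroup.toGroup (f := fun a => (hu a).unit) (by
      rintro _ ⟨a, b, c, h, rfl⟩
      simp only [map_mul, map_inv, FreeGroup.lift_apply_of]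
      rw [mul_inv_eq_one, mul_assoc, inv_mul_eq_iff_eq_mul]
      ext
      simp only [Units.val_mul, IsUnit.unit_spec, ← map_mul]
      congr 1
      exact PresentedMonoid.mk_eq_mk_of_rel (FactRel.right a b c h.symm))
  have hψ : ∀ s, (ψ (toCGroup _ s) : OreLocalization (Submonoid.center _) _) = φ s := by
    intro s
    induction s using factSemigroup_induction with
    | one => simp
    | letter_mul a s ih =>
      rw [map_mul, map_mul, map_mul, Units.val_mul, ih, toCGroup_letter]
      congr 1
      exact congrArg Units.val (PresentedGroup.toGroup.of _)
  have hφ : φ s = φ t := by rw [← hψ, ← hψ, h]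
  obtain ⟨u, v, h1, h2⟩ := OreLocalization.oreDiv_eq_iff.1 hφ
  refine ⟨u, ?_⟩
  simp only [OneMemClass.coe_one, mul_one] at h2
  subst h2
  exact h1.symm

theorem exists_isFull [Finite C.carrier] (hC : Subgroup.closure C.carrier = ⊤) :
    ∃ s : FactSemigroup C.carrier, IsFull s := by
  have := Fintype.ofFinite C.carrier
  refine ⟨PresentedMonoid.mk _ (FreeMonoid.ofList Finset.univ.toList), ?_⟩
  rw [IsFull, factorSubgroup_mk, wordSubgroup, ← hC]
  congr 1
  ext g
  simp

theorem toCGroup_letter_pow_mem_center (hN : ∀ g ∈ C.carrier, g ^ N = 1) (a : C.carrier) :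
    toCGroup _ (letter a ^ N) ∈ Subgroup.center (CGroup C.carrier) := by
  rw [Subgroup.mem_center_iff]
  intro z
  refine Subgroup.mem_centralizer_singleton_iff.1 (PresentedGroup.generated_by _ _ ?_ z)
  intro b
  rw [Subgroup.mem_centralizer_singleton_iff, ← toCGroup_letter, ← map_mul, ← map_mul,
    Submonoid.mem_center_iff.1 (letter_pow_mem_center hN a)]

theorem of_conjBy (h a : C.carrier) :
    (PresentedGroup.of (conjBy (h : G) a) : CGroup C.carrier) =
      PresentedGroup.of h * PresentedGroup.of a * (PresentedGroup.of h)⁻¹ := by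
  rw [eq_mul_inv_iff_mul_eq, ← toCGroup_letter, ← toCGroup_letter, ← toCGroup_letter, ← map_mul,
    ← letter_mul_letter, map_mul]

theorem toCGroup_letter_pow_congr (hC : Subgroup.closure C.carrier = ⊤)
    (hN : ∀ g ∈ C.carrier, g ^ N = 1) (a b : C.carrier) :
    toCGroup _ (letter a ^ N) = toCGroup _ (letter b ^ N) := by
  refine eq_of_conjBy_invariant hC (fun a => toCGroup _ (letter a ^ N)) (fun h hh a => ?_) a b
  have := Subgroup.mem_center_iff.1 (toCGroup_letter_pow_mem_center hN a)
    (PresentedGroup.of ⟨h, hh⟩)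
  rw [map_pow, toCGroup_letter] at this
  rw [map_pow, map_pow, toCGroup_letter, toCGroup_letter, of_conjBy ⟨h, hh⟩ a, conj_pow, this,
    mul_inv_cancel_right]

/-- Central powers clear denominators: y_b⁻¹ y_a^N = y_b^{N-1}, since y_a^N = y_b^N. -/
theorem exists_mul_pow_eq_toCGroup (hC : Subgroup.closure C.carrier = ⊤)
    (hN : ∀ g ∈ C.carrier, g ^ N = 1) (hN0 : 0 < N) (a : C.carrier) (z : CGroup C.carrier) :
    ∃ s m, z * toCGroup _ (letter a ^ N) ^ m = toCGroup _ s := by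
  have hz : z ∈ Subgroup.closure (Set.range (PresentedGroup.of (rels := cRelators C.carrier))) :=
    PresentedGroup.closure_range_of (cRelators C.carrier) ▸ Subgroup.mem_top z
  rw [← Subgroup.mem_toSubmonoid, Subgroup.closure_toSubmonoid] at hz
  induction hz using Submonoid.closure_induction with
  | mem x hx =>
    obtain ⟨b, rfl⟩ | hx := hx
    · exact ⟨letter b, 0, by simp⟩
    · obtain ⟨b, hb⟩ := hx
      refine ⟨letter b ^ (N - 1), 1, ?_⟩
      rw [pow_one, toCGroup_letter_pow_congr hC hN a b, ← inv_inv x, ← hb, inv_mul_eq_iff_eq_mul,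
        ← toCGroup_letter, ← map_mul, mul_pow_sub_one hN0.ne']
  | one => exact ⟨1, 0, by simp⟩
  | mul x y _ _ hx hy =>
    obtain ⟨s, m, hs⟩ := hx
    obtain ⟨t, l, ht⟩ := hy
    refine ⟨s * t, m + l, ?_⟩
    have hc := Subgroup.mem_center_iff.1
      (Subgroup.pow_mem _ (toCGroup_letter_pow_mem_center hN a) m) y
    rw [map_mul, ← hs, ← ht, pow_add, mul_assoc, ← mul_assoc y, hc]
    simp only [mul_assoc]

/-- Elements of the `C`-group of large degree come from full factorizations. -/
theorem exists_isFull_toCGroup_eq [Finite C.carrier] (hC : Subgroup.closure C.carrier = ⊤)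
    (hN : ∀ g ∈ C.carrier, g ^ N = 1) (hN0 : 0 < N) {k : ℕ} (hk : Nat.card C.carrier * N ≤ k)
    {z : CGroup C.carrier} (hz : degree _ z = Multiplicative.ofAdd (k : ℤ)) :
    ∃ s, IsFull s ∧ toCGroup _ s = z := by
  obtain ⟨w, hw⟩ := exists_isFull hC
  obtain ⟨a⟩ : Nonempty C.carrier := by
    obtain ⟨g, rfl⟩ := ConjClasses.exists_rep C
    exact ⟨⟨g, ConjClasses.mem_carrier_mk⟩⟩
  -- Splitting off the full element w first makes the representative w * s full.
  obtain ⟨s, m, hs⟩ := exists_mul_pow_eq_toCGroup hC hN hN0 a ((toCGroup _ w)⁻¹ * z)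
  have hs' : z * toCGroup _ (letter a ^ N) ^ m = toCGroup _ (w * s) := by
    rw [map_mul, ← hs, mul_assoc, mul_inv_cancel_left]
  have hfull := hw.mul_right s
  generalize w * s = t at hs' hfull
  clear hs
  induction m generalizing t with
  | zero => exact ⟨t, hfull, by simpa using hs'.symm⟩
  | succ m ih =>
    have hd := congrArg (degree _) hs'
    rw [map_mul, map_pow, hz, degree_toCGroup, degree_toCGroup, ← ofAdd_nsmul, ← ofAdd_add] at hd
    have hd := Multiplicative.ofAdd.injective hd
    simp only [length_pow, length_letter, mul_one, nsmul_eq_mul] at hd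
    have hd : k + (m + 1) * N = length t := by exact_mod_cast hd
    -- The length k + (m + 1)N exceeds |C|N, so one N-th power can be removed from both sides.
    obtain ⟨b, t, ht, rfl⟩ := hfull.exists_eq_letter_pow_mul (N := N) (by rw [← hd]; nlinarith)
    refine ih t ?_ ht
    rw [pow_succ', map_mul, ← toCGroup_letter_pow_congr hC hN a b, ← mul_assoc,
      Subgroup.mem_center_iff.1 (toCGroup_letter_pow_mem_center hN a) z, mul_assoc] at hs'
    exact mul_left_cancel hs'

/-- Conjugate generators agree in the abelianization, so the abelianization map factors through the
degree. -/
theorem ker_degree (hC : Subgroup.closure C.carrier = ⊤) :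
    (degree C.carrier).ker = commutator (CGroup C.carrier) := by
  obtain ⟨a⟩ : Nonempty C.carrier := by
    obtain ⟨g, rfl⟩ := ConjClasses.exists_rep C
    exact ⟨⟨g, ConjClasses.mem_carrier_mk⟩⟩
  refine le_antisymm (fun z hz => ?_) (Abelianization.commutator_subset_ker _)
  have key : Abelianization.of = (zpowersHom (Abelianization (CGroup C.carrier))
      (Abelianization.of (PresentedGroup.of a))).comp (degree C.carrier) := by
    refine PresentedGroup.ext fun b => ?_
    rw [MonoidHom.comp_apply, degree_of, zpowersHom_apply, toAdd_ofAdd, zpow_one]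
    refine eq_of_conjBy_invariant hC
      (fun a => Abelianization.of (PresentedGroup.of a : CGroup C.carrier)) (fun h hh a => ?_) b a
    rw [of_conjBy ⟨h, hh⟩ a, map_mul, map_mul, map_inv, mul_right_comm, mul_inv_cancel, one_mul]
  rw [← Abelianization.ker_of, MonoidHom.mem_ker, key, MonoidHom.comp_apply,
    MonoidHom.mem_ker.1 hz, map_one]

theorem exists_forall_bijOn_toCGroup [Finite C.carrier] (hC : Subgroup.closure C.carrier = ⊤)
    (hN : ∀ g ∈ C.carrier, g ^ N = 1) (hN0 : 0 < N) :
    ∃ K, ∀ k, K ≤ k → Set.BijOn (toCGroup C.carrier) (fullUnitFactorizations C.carrier k)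
      {z | beta _ z = 1 ∧ degree _ z = Multiplicative.ofAdd (k : ℤ)} := by
  obtain ⟨K, hK⟩ := exists_forall_mul_left_cancel hN hN0
  refine ⟨max K (Nat.card C.carrier * N), fun k hk => ⟨?_, ?_, ?_⟩⟩
  · rintro s ⟨-, h1, rfl⟩
    exact ⟨by rw [beta_toCGroup, h1], degree_toCGroup s⟩
  · rintro s ⟨hs, -, hsk⟩ t ⟨ht, -, htk⟩ hst
    obtain ⟨c, hc⟩ := exists_mul_eq_mul_of_toCGroup_eq hN hN0 hst
    exact hK s t c hs ht (hsk.trans htk.symm) (by omega) hc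
  · rintro z ⟨hz, hzk⟩
    obtain ⟨s, hs, rfl⟩ := exists_isFull_toCGroup_eq hC hN hN0 (by omega) hzk
    refine ⟨s, ⟨hs, by rwa [beta_toCGroup] at hz, ?_⟩, rfl⟩
    rw [degree_toCGroup] at hzk
    exact_mod_cast Multiplicative.ofAdd.injective hzk

theorem image_mul_left_ambiguitySubgroup (hC : Subgroup.closure C.carrier = ⊤)
    {z : CGroup C.carrier} {d : Multiplicative ℤ} (hz : beta _ z = 1) (hd : degree _ z = d) :
    (fun x => z * x) '' (ambiguitySubgroup C.carrier : Set (CGroup C.carrier)) =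
      {z | beta _ z = 1 ∧ degree _ z = d} := by
  have hmem : ∀ x, x ∈ ambiguitySubgroup C.carrier ↔ beta _ x = 1 ∧ degree _ x = 1 := by
    intro x
    rw [ambiguitySubgroup, Subgroup.mem_inf, ← ker_degree hC, MonoidHom.mem_ker, MonoidHom.mem_ker]
  ext y
  constructor
  · rintro ⟨x, hx, rfl⟩
    obtain ⟨h1, h2⟩ := (hmem x).1 hx
    exact ⟨by simp [h1, hz], by simp [h2, hd]⟩
  · rintro ⟨h1, h2⟩
    exact ⟨z⁻¹ * y, (hmem _).2 ⟨by simp [h1, hz], by simp [h2, hd]⟩, by simp⟩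

theorem beta_toCGroup_letter_pow (hN : ∀ g ∈ C.carrier, g ^ N = 1) (a : C.carrier) :
    beta _ (toCGroup _ (letter a ^ N)) = 1 := by
  rw [beta_toCGroup, map_pow, alpha_letter, hN a a.2]

theorem finite_ambiguitySubgroup [Finite C.carrier] (hC : Subgroup.closure C.carrier = ⊤)
    (hN : ∀ g ∈ C.carrier, g ^ N = 1) (hN0 : 0 < N) :
    Finite (ambiguitySubgroup C.carrier) := by
  obtain ⟨K, hK⟩ := exists_forall_bijOn_toCGroup hC hN hN0
  obtain ⟨a⟩ : Nonempty C.carrier := by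
    obtain ⟨g, rfl⟩ := ConjClasses.exists_rep C
    exact ⟨⟨g, ConjClasses.mem_carrier_mk⟩⟩
  -- In degree K * N the fibre is nonempty: it contains y_a^{NK}.
  have hfin := (finite_fullUnitFactorizations C.carrier (K * N)).image (toCGroup C.carrier)
  rw [(hK (K * N) (Nat.le_mul_of_pos_right K hN0)).image_eq,
    ← image_mul_left_ambiguitySubgroup hC (z := toCGroup _ (letter a ^ N) ^ K)
      (by rw [map_pow, beta_toCGroup_letter_pow hN, one_pow])
      (by rw [map_pow, degree_toCGroup, ← ofAdd_nsmul]; simp)] at hfin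
  exact Set.Finite.of_finite_image hfin (mul_right_injective _).injOn

/-- For large `k`, the number `h_k` is the ambiguity index or zero, according to the residue
of `k` modulo `N`. -/
theorem exists_forall_factCount_eq [Finite C.carrier] (hC : Subgroup.closure C.carrier = ⊤)
    (hN : ∀ g ∈ C.carrier, g ^ N = 1) (hN0 : 0 < N) :
    ∃ K, ∀ k, K ≤ k → factCount C.carrier k =
      if k % N ∈ residues C.carrier N then ambiguityIndex C.carrier else 0 := by
  obtain ⟨K, hK⟩ := exists_forall_bijOn_toCGroup hC hN hN0
  obtain ⟨a⟩ : Nonempty C.carrier := by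
    obtain ⟨g, rfl⟩ := ConjClasses.exists_rep C
    exact ⟨⟨g, ConjClasses.mem_carrier_mk⟩⟩
  refine ⟨K, fun k hk => ?_⟩
  have hmod : k % N ∈ residues C.carrier N ↔ ∃ i, i ≡ k [MOD N] ∧ 0 < factCount C.carrier i := by
    classical
    refine Finset.mem_filter.trans ?_
    simp [Nat.mod_lt _ hN0, Nat.ModEq]
  split_ifs with hr
  · obtain ⟨i, hik, hi⟩ := hmod.1 hr
    obtain ⟨s, -, h1, rfl⟩ := (Set.ncard_pos (finite_fullUnitFactorizations _ i)).1 hi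
    -- The index i may be small or exceed k. The exponent e is an integer, possibly negative, which
    -- is harmless in the C-group.
    obtain ⟨e, he⟩ := hik.dvd
    rw [factCount, (hK k hk).ncard_eq,
      ← image_mul_left_ambiguitySubgroup hC (z := toCGroup _ s * toCGroup _ (letter a ^ N) ^ e)
      (by rw [map_mul, map_zpow, beta_toCGroup_letter_pow hN, one_zpow, beta_toCGroup, h1, one_mul])
      (by
        rw [map_mul, map_zpow, degree_toCGroup, degree_toCGroup, ← ofAdd_zsmul, ← ofAdd_add]
        congr 1
        simp only [length_pow, length_letter, mul_one, smul_eq_mul]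
        linarith),
      Set.ncard_image_of_injective _ (mul_right_injective _)]
    rfl
  · by_contra h
    exact hr (hmod.2 ⟨k, rfl, Nat.pos_of_ne_zero h⟩)

end CGroup

end EquippedGroup

/-! ### Power series with eventually periodic coefficients. -/

/-- A power series whose coefficients from `T` on depend only on membership of the residue modulo
`N` in `R`, minus its truncation, is a polynomial divided by `1 - X ^ N`. -/
theorem PowerSeries.sub_trunc_mul_one_sub_X_pow {K : Type*} [CommRing K] (f : PowerSeries K)
    (a : K) {N T : ℕ} (hT : N ∣ T) {R : Finset ℕ} (hR : ∀ r ∈ R, r < N)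
    (hf : ∀ k, T ≤ k → PowerSeries.coeff k f = if k % N ∈ R then a else 0) :
    (f - (PowerSeries.trunc T f : PowerSeries K)) * (1 - PowerSeries.X ^ N) =
      PowerSeries.C a * (PowerSeries.X ^ T * ∑ r ∈ R, PowerSeries.X ^ r) := by
  have hg : ∀ k, PowerSeries.coeff k (f - (PowerSeries.trunc T f : PowerSeries K)) =
      if k < T then 0 else if k % N ∈ R then a else 0 := by
    intro k
    rw [map_sub, Polynomial.coeff_coe, PowerSeries.coeff_trunc]
    split_ifs with h1 h2
    · simp
    · simp [hf k (by omega), h2]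
    · simp [hf k (by omega), h2]
  ext k
  rw [mul_sub, mul_one, map_sub, PowerSeries.coeff_mul_X_pow', hg, hg,
    PowerSeries.coeff_C_mul, PowerSeries.coeff_X_pow_mul']
  simp only [map_sum, PowerSeries.coeff_X_pow, Finset.sum_ite_eq]
  obtain ⟨q, rfl⟩ := hT
  by_cases h1 : k < N * q
  · have h2 : k - N < N * q := by omega
    simp [h1, h2]
  · obtain ⟨j, rfl⟩ := Nat.exists_eq_add_of_le (not_lt.1 h1)
    rw [if_neg h1, if_pos (not_lt.1 h1), Nat.add_sub_cancel_left, Nat.mul_add_mod]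
    -- In the first period after T the shifted series contributes nothing; later, the two terms
    -- cancel by periodicity.
    by_cases h2 : j < N
    · rw [Nat.mod_eq_of_lt h2]
      have h3 : N ≤ N * q + j → N * q + j - N < N * q := by omega
      by_cases h4 : N ≤ N * q + j
      · simp [h4, h3 h4]
      · simp [h4]
    · obtain ⟨i, rfl⟩ := Nat.exists_eq_add_of_le (not_lt.1 h2)
      have h3 : N ≤ N * q + (N + i) := by omega
      have h4 : N * q + (N + i) - N = N * q + i := by omega
      have h5 : N + i ∉ R := fun h => h2 (hR _ h)
      simp [h3, h4, h5]

open scoped RatFunc in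
/-- A power series whose coefficients from `T` on depend only on membership of the residue modulo
`N` in `R` is a rational function of an explicit form. -/
theorem PowerSeries.coe_eq_of_coeff_eventually_periodic {K : Type*} [Field K] (f : PowerSeries K)
    (a : K) {N T : ℕ} (hN : 0 < N) (hT : N ∣ T) {R : Finset ℕ} (hR : ∀ r ∈ R, r < N)
    (hf : ∀ k, T ≤ k → PowerSeries.coeff k f = if k % N ∈ R then a else 0) :
    (f : LaurentSeries K) =
      ((algebraMap (Polynomial K) (RatFunc K) (PowerSeries.trunc T f) +
        RatFunc.C a * RatFunc.X ^ T / (1 - RatFunc.X ^ N) * ∑ r ∈ R, RatFunc.X ^ r :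
          RatFunc K) : LaurentSeries K) := by
  have key := f.sub_trunc_mul_one_sub_X_pow a hT hR hf
  have hX : algebraMap (RatFunc K) (LaurentSeries K) RatFunc.X =
      HahnSeries.ofPowerSeries ℤ K PowerSeries.X :=
    RatFunc.coe_X.trans PowerSeries.coe_X.symm
  have hC : algebraMap (RatFunc K) (LaurentSeries K) (RatFunc.C a) =
      HahnSeries.ofPowerSeries ℤ K (PowerSeries.C a) := by
    have h := RatFunc.coe_coe (Polynomial.C a)
    rw [Polynomial.coe_C] at h
    exact h.symm
  have hne : (1 - HahnSeries.ofPowerSeries ℤ K PowerSeries.X ^ N) ≠ 0 := by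
    rw [← map_one (HahnSeries.ofPowerSeries ℤ K), ← map_pow, ← map_sub,
      map_ne_zero_iff _ HahnSeries.ofPowerSeries_injective]
    intro h
    simpa [hN.ne'] using congrArg PowerSeries.constantCoeff h
  have key' := congrArg (HahnSeries.ofPowerSeries ℤ K) key
  simp only [map_mul, map_sub, map_one, map_pow, map_sum] at key'
  rw [map_add]
  simp only [map_mul, map_div₀, map_sub, map_one, map_pow, map_sum, hX, hC]
  rw [← sub_eq_iff_eq_add', div_mul_eq_mul_div, eq_div_iff hne, mul_assoc, ← key',
    RatFunc.coe_coe]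
  rfl

/-! ### The rational form of the generating function. -/

theorem mainTheorem9 {G : Type*} [Group G] [Finite G] (C : ConjClasses G)
    (hC : Subgroup.closure C.carrier = ⊤) :
    (∃ f : RatFunc ℚ, (f : LaurentSeries ℚ) = (EquippedGroup.chi C : LaurentSeries ℚ)) ∧
    Finite (EquippedGroup.ambiguitySubgroup C.carrier) ∧
    ∀ p n : ℕ, 0 < p → n = C.carrier.ncard → (∀ g ∈ C.carrier, g ^ (p * n) = 1) →
      ∃ T₀ : ℕ, ∀ T : ℕ, T₀ ≤ T → p * n ∣ T →
        (EquippedGroup.chi C : LaurentSeries ℚ) =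
          ((algebraMap (Polynomial ℚ) (RatFunc ℚ) (PowerSeries.trunc T (EquippedGroup.chi C)) +
              (EquippedGroup.ambiguityIndex C.carrier : RatFunc ℚ) * RatFunc.X ^ T /
                  (1 - RatFunc.X ^ (p * n)) *
                ∑ r ∈ EquippedGroup.residues C.carrier (p * n), RatFunc.X ^ r :
            RatFunc ℚ) : LaurentSeries ℚ) := by
  classical
  have hfin : Finite C.carrier := Subtype.finite
  have hn : 0 < C.carrier.ncard := by
    rw [Set.ncard_pos]
    obtain ⟨g, rfl⟩ := ConjClasses.exists_rep C
    exact ⟨g, ConjClasses.mem_carrier_mk⟩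
  -- Rationality and finiteness do not involve p, so p = |G| serves for both.
  have hG : ∀ g ∈ C.carrier, g ^ (Nat.card G * C.carrier.ncard) = 1 := fun g _ => by
    rw [pow_mul, pow_card_eq_one', one_pow]
  have main : ∀ p n : ℕ, 0 < p → n = C.carrier.ncard → (∀ g ∈ C.carrier, g ^ (p * n) = 1) →
      ∃ T₀ : ℕ, ∀ T : ℕ, T₀ ≤ T → p * n ∣ T →
        (EquippedGroup.chi C : LaurentSeries ℚ) =
          ((algebraMap (Polynomial ℚ) (RatFunc ℚ) (PowerSeries.trunc T (EquippedGroup.chi C)) +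
              (EquippedGroup.ambiguityIndex C.carrier : RatFunc ℚ) * RatFunc.X ^ T /
                  (1 - RatFunc.X ^ (p * n)) *
                ∑ r ∈ EquippedGroup.residues C.carrier (p * n), RatFunc.X ^ r :
            RatFunc ℚ) : LaurentSeries ℚ) := by
    rintro p n hp rfl hN
    have hN0 := Nat.mul_pos hp hn
    obtain ⟨K, hK⟩ := EquippedGroup.exists_forall_factCount_eq hC hN hN0
    refine ⟨K, fun T hT hdvd => ?_⟩
    rw [← map_natCast RatFunc.C]
    refine PowerSeries.coe_eq_of_coeff_eventually_periodic _ _ hN0 hdvd (fun r hr => ?_)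
      fun k hk => ?_
    · exact Finset.mem_range.1 (Finset.mem_filter.1 hr).1
    · rw [EquippedGroup.chi, PowerSeries.coeff_mk, hK k (hT.trans hk)]
      split_ifs <;> simp
  refine ⟨?_, EquippedGroup.finite_ambiguitySubgroup hC hG (Nat.mul_pos Nat.card_pos hn), main⟩
  obtain ⟨T₀, hT₀⟩ := main _ _ Nat.card_pos rfl hG
  exact ⟨_, (hT₀ _ (Nat.le_mul_of_pos_right T₀ (Nat.mul_pos Nat.card_pos hn))
    (Dvd.intro_left _ rfl)).symm⟩
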